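/- Let $p$ be an odd prime, let $n\ge 4$ be an integer with $(n,p)\ne(6,3)$, let $q$ be a power of a prime different from $p$, and let $\epsilon\in\{+,-\}$. Let $G=\operatorname{SL}^{\epsilon}(n,q)$, where $\operatorname{SL}^{+}(n,q)=\operatorname{SL}(n,\mathbb F_q)$ is the special linear group and $\operatorname{SL}^{-}(n,q)=\operatorname{SU}(n,q)$ is the special unitary group, consisting of all matrices $A\in\operatorname{SL}(n,\mathbb F_{q^2})$ with $A\bar A^{\mathsf T}=I$, where $\bar A$ is obtained from $A$ by raising each entry to the power $q$. Let $S=G/\mathbf Z(G)=\operatorname{PSL}^{\epsilon}(n,q)$ and let $P$ be a Sylow $p$-subgroup of $S$. If $P/\mathbf Z(P)$ is abelian, then $p$ does not divide $|\mathbf Z(G)|$. -/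

import Mathlib

open scoped MatrixGroups

/-- The conjugation `x ↦ x ^ q` of an extension `K` of the finite field `F`, where `q = |F|`.
When `K` has degree 2 over `F`, so `|K| = q ^ 2`, it is the involution whose fixed field is `F`. -/
noncomputable def unitaryConj (F K : Type*) [Field F] [Fintype F] [Field K] [Algebra F K] :
    K →+* K :=
  (FiniteField.frobeniusAlgHom F K : K →+* K)

theorem unitaryConj_apply (F K : Type*) [Field F] [Fintype F] [Field K] [Algebra F K] (x : K) :
    unitaryConj F K x = x ^ Fintype.card F := rfl

/-- The special unitary group `SU(n, q)`, where `q = |F|` and `K` is the extension of `F` of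
degree 2: all `A` in `SL(n, K)` with `A * Āᵀ = 1`, where `Ā` is obtained from `A` by raising
every entry to the power `q`. -/
noncomputable def finiteSU (n : ℕ) (F K : Type*) [Field F] [Fintype F] [Field K] [Algebra F K] :
    Subgroup SL(n, K) where
  carrier := {A | (A : Matrix (Fin n) (Fin n) K) *
    ((A : Matrix (Fin n) (Fin n) K).map (unitaryConj F K)).transpose = 1}
  one_mem' := by simp
  mul_mem' := by
    intro A B hA hB
    simp only [Set.mem_setOf_eq, Matrix.SpecialLinearGroup.coe_mul, Matrix.map_mul,
      Matrix.transpose_mul] at hA hB ⊢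
    rw [Matrix.mul_assoc, ← Matrix.mul_assoc (B : Matrix (Fin n) (Fin n) K), hB, Matrix.one_mul, hA]
  inv_mem' := by
    intro A hA
    simp only [Set.mem_setOf_eq] at hA ⊢
    have h1 : ((A⁻¹ : SL(n, K)) : Matrix (Fin n) (Fin n) K) * (A : Matrix (Fin n) (Fin n) K) = 1 := by
      rw [← Matrix.SpecialLinearGroup.coe_mul, inv_mul_cancel, Matrix.SpecialLinearGroup.coe_one]
    have h2 : ((A⁻¹ : SL(n, K)) : Matrix (Fin n) (Fin n) K)
        = ((A : Matrix (Fin n) (Fin n) K).map (unitaryConj F K)).transpose := by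
      calc _ = ((A⁻¹ : SL(n, K)) : Matrix (Fin n) (Fin n) K) * ((A : Matrix (Fin n) (Fin n) K) *
            ((A : Matrix (Fin n) (Fin n) K).map (unitaryConj F K)).transpose) := by
              rw [hA, Matrix.mul_one]
        _ = _ := by rw [← Matrix.mul_assoc, h1, Matrix.one_mul]
    have h3 := congrArg (fun M : Matrix (Fin n) (Fin n) K =>
      (M.map (unitaryConj F K)).transpose) h1
    simp only [Matrix.map_mul, Matrix.transpose_mul] at h3
    rw [← h2] at h3
    simpa using h3

/-- The projective special unitary group `PSU(n, q) = SU(n, q) / Z(SU(n, q))`, `q = |F|`. -/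
abbrev FinitePSU (n : ℕ) (F K : Type*) [Field F] [Fintype F] [Field K] [Algebra F K] : Type _ :=
  finiteSU n F K ⧸ Subgroup.center (finiteSU n F K)

/-! If `p` divides the order of the centre, Cauchy gives a central element of order `p`. It is a
scalar `ζ`, and determinant one forces `p ∣ n`, so `p ≤ n` and there is a `p`-cycle `σ`, which is
even because `p` is odd. Let `x` be the permutation matrix of `σ` and `y = diag(ζ, 1, …, 1, ζ⁻¹)`.
Together with the diagonal matrices of exponent `p`, `x` generates a `p`-group containing `y`. If
`P/Z(P)` is abelian, Sylow conjugacy makes `[x, [x, y]]` central in `G`. This matrix is diagonal,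
while even permutation matrices force a central diagonal matrix to be scalar; two of its entries
differ, a contradiction. `false_of_sylow_quotient_comm` runs this for any finite group `G` embedded
in matrices, covering SL and SU together. For SU, the centre must first be shown to be scalar. -/

open scoped commutatorElement

/-! ### Class at most two modulo the centre -/

section GroupTheory

variable {G : Type*} [Group G]

/-- In a quotient of a group with abelian central quotient by its centre, commutators are central. -/
theorem commutatorElement_mem_center_of_quotient_comm
    (h : ∀ a b : G ⧸ Subgroup.center G, a * b = b * a) (a b : G) : ⁅a, b⁆ ∈ Subgroup.center G := by
  rw [← QuotientGroup.eq_one_iff, ← QuotientGroup.mk'_apply, map_commutatorElement,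
    commutatorElement_eq_one_iff_mul_comm]
  exact h _ _

theorem commutatorElement_commutatorElement_eq_one_of_le
    {P Q : Subgroup G} (h : ∀ a b : P ⧸ Subgroup.center P, a * b = b * a) (hQ : Q ≤ P)
    {a b c : G} (ha : a ∈ Q) (hb : b ∈ Q) (hc : c ∈ Q) : ⁅a, ⁅b, c⁆⁆ = 1 := by
  have h1 := commutatorElement_mem_center_of_quotient_comm h ⟨b, hQ hb⟩ ⟨c, hQ hc⟩
  have h2 := Subgroup.mem_center_iff.mp h1 ⟨a, hQ ha⟩
  rw [commutatorElement_eq_one_iff_mul_comm]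
  exact congrArg Subtype.val h2

/-- If one Sylow `p`-subgroup has abelian central quotient, then every `p`-subgroup is nilpotent
of class at most two. -/
theorem IsPGroup.commutatorElement_commutatorElement_eq_one [Finite G] {p : ℕ} [Fact p.Prime]
    (P : Sylow p G) (h : ∀ a b : P ⧸ Subgroup.center P, a * b = b * a)
    {Q : Subgroup G} (hQ : IsPGroup p Q) {a b c : G} (ha : a ∈ Q) (hb : b ∈ Q) (hc : c ∈ Q) :
    ⁅a, ⁅b, c⁆⁆ = 1 := by
  obtain ⟨R, hR⟩ := hQ.exists_le_sylow
  obtain ⟨g, rfl⟩ := MulAction.exists_smul_eq G P R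
  have key : ∀ x ∈ Q, MulAut.conj g⁻¹ x ∈ (P : Subgroup G) := by
    intro x hx
    have := hR hx
    rw [Sylow.coe_subgroup_smul, Subgroup.mem_pointwise_smul_iff_inv_smul_mem] at this
    simpa using this
  have := commutatorElement_commutatorElement_eq_one_of_le h le_rfl (key a ha) (key b hb) (key c hc)
  rw [← map_commutatorElement, ← map_commutatorElement] at this
  exact (map_eq_one_iff _ (MulAut.conj g⁻¹).injective).mp this

/-- The image of a `p`-group in the central quotient is a `p`-group, so the class bound there can be
tested on matrices upstairs. -/
theorem IsPGroup.commutatorElement_commutatorElement_mem_center [Finite G] {p : ℕ} [Fact p.Prime]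
    (P : Sylow p (G ⧸ Subgroup.center G)) (h : ∀ a b : P ⧸ Subgroup.center P, a * b = b * a)
    {Q : Subgroup G} (hQ : IsPGroup p Q) {a b c : G} (ha : a ∈ Q) (hb : b ∈ Q) (hc : c ∈ Q) :
    ⁅a, ⁅b, c⁆⁆ ∈ Subgroup.center G := by
  rw [← QuotientGroup.eq_one_iff, ← QuotientGroup.mk'_apply, map_commutatorElement,
    map_commutatorElement]
  exact IsPGroup.commutatorElement_commutatorElement_eq_one P h (hQ.map _)
    (Subgroup.mem_map_of_mem _ ha) (Subgroup.mem_map_of_mem _ hb) (Subgroup.mem_map_of_mem _ hc)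

end GroupTheory

/-! ### Permutation and diagonal matrices -/

section Monomial

variable {m K G : Type*} [Fintype m] [DecidableEq m] [Field K] [Group G]

theorem permMatrixHom_mul_diagonal (σ : Equiv.Perm m) (v : m → K) :
    Matrix.permMatrixHom (R := K) σ * Matrix.diagonal v =
      Matrix.diagonal (v ∘ ⇑σ⁻¹) * Matrix.permMatrixHom (R := K) σ := by
  ext i j
  simp only [Matrix.permMatrixHom_apply, Matrix.mul_diagonal, Matrix.diagonal_mul,
    Equiv.Perm.permMatrix, PEquiv.toMatrix_apply, Equiv.toPEquiv_apply,
    Option.mem_def, Option.some.injEq, Function.comp_apply]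
  split_ifs with h
  · rw [h, mul_comm]
  · simp

/-- `g` is represented by the diagonal matrix with entries `v`. -/
def IsDiagonalRep (ι : G →* Matrix m m K) (g : G) (v : m → Kˣ) : Prop :=
  ι g = Matrix.diagonal fun i => (v i : K)

namespace IsDiagonalRep

variable {ι : G →* Matrix m m K} {g h x : G} {v w : m → Kˣ}

theorem one : IsDiagonalRep ι 1 1 := by simp [IsDiagonalRep]

theorem mul (hg : IsDiagonalRep ι g v) (hh : IsDiagonalRep ι h w) :
    IsDiagonalRep ι (g * h) (v * w) := by
  rw [IsDiagonalRep] at *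
  rw [map_mul, hg, hh, Matrix.diagonal_mul_diagonal]
  simp

theorem inv (hg : IsDiagonalRep ι g v) : IsDiagonalRep ι g⁻¹ v⁻¹ := by
  -- `ι` takes values in a monoid, so `ι g⁻¹` is identified through a right inverse of `ι g`.
  have h1 : ι g * Matrix.diagonal (fun i => ((v⁻¹ i : Kˣ) : K)) = 1 := by
    rw [hg, Matrix.diagonal_mul_diagonal]
    simp
  calc ι g⁻¹ = ι g⁻¹ * (ι g * Matrix.diagonal (fun i => ((v⁻¹ i : Kˣ) : K))) := by rw [h1, mul_one]
    _ = _ := by rw [← mul_assoc, ← map_mul, inv_mul_cancel, map_one, one_mul]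

theorem pow (hg : IsDiagonalRep ι g v) (k : ℕ) : IsDiagonalRep ι (g ^ k) (v ^ k) := by
  induction k with
  | zero => simpa using one
  | succ k ih => simpa only [pow_succ] using ih.mul hg

theorem conj {σ : Equiv.Perm m} (hg : IsDiagonalRep ι g v)
    (hx : ι x = Matrix.permMatrixHom (R := K) σ) : IsDiagonalRep ι (x * g * x⁻¹) (v ∘ ⇑σ⁻¹) := by
  have h1 := permMatrixHom_mul_diagonal σ fun i => (v i : K)
  rw [IsDiagonalRep] at *
  rw [map_mul, map_mul, hg, hx, h1, mul_assoc, ← hx, ← map_mul, mul_inv_cancel, map_one, mul_one]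
  rfl

theorem commutatorElement {σ : Equiv.Perm m} (hg : IsDiagonalRep ι g v)
    (hx : ι x = Matrix.permMatrixHom (R := K) σ) : IsDiagonalRep ι ⁅x, g⁆ (v ∘ ⇑σ⁻¹ * v⁻¹) :=
  (hg.conj hx).mul hg.inv

/-- Conjugation by `x` permutes the diagonal entries, yet fixes a central element. -/
theorem apply_eq_of_mem_center {σ : Equiv.Perm m} (hg : IsDiagonalRep ι g v)
    (hx : ι x = Matrix.permMatrixHom (R := K) σ) (hc : g ∈ Subgroup.center G) (i : m) :
    v (σ i) = v i := by
  have h1 := hg.conj hx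
  rw [Subgroup.mem_center_iff.mp hc x, mul_inv_cancel_right] at h1
  have h2 := Matrix.diagonal_injective (hg.symm.trans h1)
  simpa using Units.ext (congrFun h2 (σ i))

end IsDiagonalRep

/-- The elements represented by diagonal matrices whose entries are `p`-th roots of unity. -/
def diagonalTorsion (ι : G →* Matrix m m K) (p : ℕ) : Subgroup G where
  carrier := {g | ∃ v : m → Kˣ, IsDiagonalRep ι g v ∧ v ^ p = 1}
  one_mem' := ⟨1, .one, one_pow p⟩
  mul_mem' := by
    rintro g h ⟨v, hg, hv⟩ ⟨w, hh, hw⟩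
    exact ⟨v * w, hg.mul hh, by rw [mul_pow, hv, hw, one_mul]⟩
  inv_mem' := by
    rintro g ⟨v, hg, hv⟩
    exact ⟨v⁻¹, hg.inv, by rw [inv_pow, hv, inv_one]⟩

theorem isPGroup_diagonalTorsion {ι : G →* Matrix m m K} (hι : Function.Injective ι) (p : ℕ) :
    IsPGroup p (diagonalTorsion ι p) := by
  rintro ⟨g, v, hg, hv⟩
  refine ⟨1, Subtype.ext (hι ?_)⟩
  have h1 := hg.pow p
  rw [hv] at h1
  simpa [IsDiagonalRep] using h1

theorem zpowers_le_normalizer_diagonalTorsion {ι : G →* Matrix m m K} (p : ℕ) {x : G}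
    {σ : Equiv.Perm m} (hx : ι x = Matrix.permMatrixHom (R := K) σ) :
    Subgroup.zpowers x ≤ Subgroup.normalizer (diagonalTorsion ι p : Set G) := by
  have key : ∀ (y : G) (τ : Equiv.Perm m), ι y = Matrix.permMatrixHom (R := K) τ →
      ∀ g ∈ diagonalTorsion ι p, y * g * y⁻¹ ∈ diagonalTorsion ι p := by
    rintro y τ hy g ⟨v, hg, hv⟩
    exact ⟨_, hg.conj hy, funext fun i => congrFun hv _⟩
  have hx' : ι x⁻¹ = Matrix.permMatrixHom (R := K) σ⁻¹ := by
    calc ι x⁻¹ = ι x⁻¹ * (ι x * Matrix.permMatrixHom (R := K) σ⁻¹) := by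
          rw [hx, ← map_mul, mul_inv_cancel, map_one, mul_one]
      _ = _ := by rw [← mul_assoc, ← map_mul, inv_mul_cancel, map_one, one_mul]
  rw [Subgroup.zpowers_le, Subgroup.mem_normalizer_iff]
  refine fun g => ⟨key x σ hx g, fun h => ?_⟩
  simpa [mul_assoc] using key _ _ hx' _ h

end Monomial

/-! ### Even permutations and the double commutator -/

/-- The cycle is `0 → 1 → ⋯ → p - 1 → 0`. The alternatives are `p = 3`, where `3` is fixed, and `p ≥
5`, where `5 ≤ n` keeps `3` away from the last index. -/
theorem exists_perm_pow_eq_one_of_le {n p : ℕ} (hp : p.Prime) (hp2 : p ≠ 2) (hn : 4 ≤ n)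
    (hpn : p ≤ n) :
    ∃ σ : Equiv.Perm (Fin n), σ ^ p = 1 ∧ σ ⟨0, by lia⟩ = ⟨1, by lia⟩ ∧
      σ ⟨1, by lia⟩ = ⟨2, by lia⟩ ∧
      (σ ⟨3, by lia⟩ = ⟨3, by lia⟩ ∨ σ ⟨2, by lia⟩ = ⟨3, by lia⟩ ∧ 5 ≤ n) := by
  have : NeZero n := ⟨by lia⟩
  have h3 : 3 ≤ p := by have := hp.two_le; lia
  refine ⟨Fin.cycleRange ⟨p - 1, by lia⟩, ?_, ?_, ?_, ?_⟩
  · rw [← orderOf_dvd_iff_pow_eq_one, ← Equiv.Perm.lcm_cycleType, Fin.cycleType_cycleRange]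
    · simp [show p - 1 + 1 = p by lia]
    · simp [Fin.ext_iff]; lia
  · ext; rw [Fin.coe_cycleRange_of_lt (by simp [Fin.lt_def]; lia)]
  · ext; rw [Fin.coe_cycleRange_of_lt (by simp [Fin.lt_def]; lia)]
  · rcases h3.eq_or_lt with h | h
    · left
      rw [Fin.cycleRange_of_gt (by simp [Fin.lt_def]; lia)]
    · have : p ≠ 4 := by rintro rfl; revert hp; decide
      refine .inr ⟨?_, by lia⟩
      ext; rw [Fin.coe_cycleRange_of_lt (by simp [Fin.lt_def]; lia)]

/-- A transposition is odd; a 3-cycle through a third point does the same job. -/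
theorem exists_perm_sign_eq_one {m : Type*} [Fintype m] [DecidableEq m]
    (hm : 3 ≤ Fintype.card m) {i j : m} (hij : i ≠ j) :
    ∃ σ : Equiv.Perm m, Equiv.Perm.sign σ = 1 ∧ σ i = j := by
  obtain ⟨k, hk⟩ : ∃ k, k ∉ ({i, j} : Finset m) := by
    by_contra! h
    have := Finset.card_le_card (fun x _ => h x : Finset.univ ⊆ {i, j})
    have := Finset.card_le_two (a := i) (b := j)
    rw [Finset.card_univ] at *
    lia
  simp only [Finset.mem_insert, Finset.mem_singleton, not_or] at hk
  refine ⟨Equiv.swap k i * Equiv.swap i j, ?_, ?_⟩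
  · rw [map_mul, Equiv.Perm.sign_swap hk.1, Equiv.Perm.sign_swap hij]; rfl
  · rw [Equiv.Perm.mul_apply, Equiv.swap_apply_left]
    exact Equiv.swap_apply_of_ne_of_ne (Ne.symm hk.2) hij.symm

/-- A group of matrices that contains the even permutation matrices and a suitable diagonal matrix
of order `p` has a `p`-subgroup which modulo the centre is not of class at most two. -/
theorem false_of_sylow_quotient_comm {n p : ℕ} (hp : p.Prime) (hp2 : p ≠ 2) (hn : 4 ≤ n)
    (hpn : p ≤ n) {K G : Type*} [Field K] [Group G] [Finite G]
    (ι : G →* Matrix (Fin n) (Fin n) K) (hι : Function.Injective ι)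
    (hperm : ∀ σ : Equiv.Perm (Fin n), Equiv.Perm.sign σ = 1 →
      ∃ g, ι g = Matrix.permMatrixHom (R := K) σ)
    {ζ : Kˣ} (hζ : orderOf ζ = p) {y : G}
    (hy : IsDiagonalRep ι y (Pi.mulSingle ⟨0, by lia⟩ ζ * Pi.mulSingle ⟨n - 1, by lia⟩ ζ⁻¹))
    (P : Sylow p (G ⧸ Subgroup.center G))
    (h : ∀ a b : P ⧸ Subgroup.center P, a * b = b * a) : False := by
  have : Fact p.Prime := ⟨hp⟩
  obtain ⟨σ, hσ, h01, h12, h3⟩ := exists_perm_pow_eq_one_of_le hp hp2 hn hpn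
  have hs : Equiv.Perm.sign σ = 1 := by
    have h1 : Equiv.Perm.sign σ ^ p = 1 := by rw [← map_pow, hσ, map_one]
    rcases Int.units_eq_one_or (Equiv.Perm.sign σ) with h2 | h2
    · exact h2
    · rw [h2, (hp.odd_of_ne_two hp2).neg_one_pow] at h1
      exact absurd h1 (by decide)
  obtain ⟨x, hx⟩ := hperm σ hs
  have hζp : ζ ^ p = 1 := hζ ▸ pow_orderOf_eq_one ζ
  have hxp : IsPGroup p (Subgroup.zpowers x) := by
    have h1 : x ^ p = 1 := hι (by rw [map_pow, hx, ← map_pow, hσ, map_one, map_one])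
    rintro ⟨u, hu⟩
    obtain ⟨k, rfl⟩ := Subgroup.mem_zpowers_iff.mp hu
    refine ⟨1, Subtype.ext ?_⟩
    rw [pow_one, Subgroup.coe_pow, Subgroup.coe_one, ← zpow_natCast, ← zpow_mul, mul_comm, zpow_mul, zpow_natCast, h1, one_zpow]
  have hQ := hxp.to_sup_of_normal_right' (isPGroup_diagonalTorsion hι p)
    (zpowers_le_normalizer_diagonalTorsion p hx)
  have hyQ : y ∈ diagonalTorsion ι p := by
    refine ⟨_, hy, ?_⟩
    rw [mul_pow, ← Pi.mulSingle_pow, ← Pi.mulSingle_pow, inv_pow, hζp]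
    simp
  have hxQ := Subgroup.mem_sup_left (T := diagonalTorsion ι p) (Subgroup.mem_zpowers x)
  have hc := IsPGroup.commutatorElement_commutatorElement_mem_center P h hQ hxQ hxQ
    (Subgroup.mem_sup_right hyQ)
  have hr := (hy.commutatorElement hx).commutatorElement hx
  obtain ⟨τ, hτ, hτ32⟩ := exists_perm_sign_eq_one (m := Fin n) (by simp; lia)
    (i := ⟨2, by lia⟩) (j := ⟨3, by lia⟩) (by simp)
  obtain ⟨t, ht⟩ := hperm τ hτ
  have h23 := hr.apply_eq_of_mem_center ht hc ⟨2, by lia⟩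
  have i1 : σ⁻¹ ⟨1, by lia⟩ = ⟨0, by lia⟩ := by rw [Equiv.Perm.inv_eq_iff_eq, h01]
  have i2 : σ⁻¹ ⟨2, by lia⟩ = ⟨1, by lia⟩ := by rw [Equiv.Perm.inv_eq_iff_eq, h12]
  have hζ1 : ζ ≠ 1 := fun h1 => hp.ne_one (by rw [← hζ, h1, orderOf_one])
  set v : Fin n → Kˣ := Pi.mulSingle ⟨0, by lia⟩ ζ * Pi.mulSingle ⟨n - 1, by lia⟩ ζ⁻¹
  have v0 : v ⟨0, by lia⟩ = ζ := by
    simp [v, show 0 ≠ n - 1 by lia]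
  have v1 : v ⟨1, by lia⟩ = 1 := by
    simp [v, show 1 ≠ n - 1 by lia]
  have v2 : v ⟨2, by lia⟩ = 1 := by
    simp [v, show 2 ≠ n - 1 by lia]
  simp only [hτ32, Pi.mul_apply, Pi.inv_apply, Function.comp_apply, i1, i2, v0, v1, v2] at h23
  -- The entry of `[x, [x, y]]` at `i` is `v (σ⁻² i) * v (σ⁻¹ i)⁻² * v i`: it is `ζ` at `2`, and `1`
  -- at `3` in both cases.
  rcases h3 with h3 | ⟨h3, hn5⟩
  · have i3 : σ⁻¹ ⟨3, by lia⟩ = ⟨3, by lia⟩ := by rw [Equiv.Perm.inv_eq_iff_eq, h3]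
    simp only [i3] at h23
    exact hζ1 (by simpa using h23.symm)
  · have i3 : σ⁻¹ ⟨3, by lia⟩ = ⟨2, by lia⟩ := by rw [Equiv.Perm.inv_eq_iff_eq, h3]
    have v3 : v ⟨3, by lia⟩ = 1 := by
      simp [v, show 3 ≠ n - 1 by lia]
    simp only [i2, i3, v1, v2, v3] at h23
    exact hζ1 (by simpa using h23.symm)

/-! ### Monomial elements and the centre of SU -/

theorem diagonal_mem_finiteSU {n : ℕ} {F K : Type*} [Field F] [Fintype F] [Field K]
    [Algebra F K] (B : SL(n, K)) {v : Fin n → Kˣ}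
    (hB : (B : Matrix (Fin n) (Fin n) K) = Matrix.diagonal fun i => (v i : K))
    (hv : v ^ (Fintype.card F + 1) = 1) : B ∈ finiteSU n F K := by
  change (B : Matrix (Fin n) (Fin n) K) *
    ((B : Matrix (Fin n) (Fin n) K).map (unitaryConj F K)).transpose = 1
  rw [hB, Matrix.diagonal_map (map_zero _), Matrix.diagonal_transpose,
    Matrix.diagonal_mul_diagonal, ← Matrix.diagonal_one]
  congr 1
  funext i
  rw [unitaryConj_apply, ← pow_succ']
  simpa using congrArg Units.val (congrFun hv i)

theorem permMatrixHom_mem_finiteSU {n : ℕ} {F K : Type*} [Field F] [Fintype F] [Field K]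
    [Algebra F K] (B : SL(n, K)) {σ : Equiv.Perm (Fin n)}
    (hB : (B : Matrix (Fin n) (Fin n) K) = Matrix.permMatrixHom σ) : B ∈ finiteSU n F K := by
  change (B : Matrix (Fin n) (Fin n) K) *
    ((B : Matrix (Fin n) (Fin n) K).map (unitaryConj F K)).transpose = 1
  have h1 : (Matrix.permMatrixHom (R := K) σ).map (unitaryConj F K) =
      Matrix.permMatrixHom σ := by
    simp only [Matrix.permMatrixHom_apply]
    exact PEquiv.map_toMatrix _ _
  rw [hB, h1]
  nth_rw 2 [Matrix.permMatrixHom_apply]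
  rw [Matrix.transpose_permMatrix, ← Matrix.permMatrixHom_apply, ← map_mul, mul_inv_cancel,
    map_one]

theorem exists_specialLinearGroup_eq_permMatrixHom {n : ℕ} (K : Type*) [Field K]
    {σ : Equiv.Perm (Fin n)} (hσ : Equiv.Perm.sign σ = 1) :
    ∃ B : SL(n, K), (B : Matrix (Fin n) (Fin n) K) = Matrix.permMatrixHom σ :=
  ⟨⟨Matrix.permMatrixHom σ, by simp [hσ]⟩, rfl⟩

theorem exists_specialLinearGroup_eq_diagonal {n : ℕ} {K : Type*} [Field K] (i j : Fin n)
    (ζ : Kˣ) :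
    ∃ B : SL(n, K), (B : Matrix (Fin n) (Fin n) K) =
      Matrix.diagonal fun k => ((Pi.mulSingle i ζ * Pi.mulSingle j ζ⁻¹ : Fin n → Kˣ) k : K) := by
  refine ⟨⟨Matrix.diagonal fun k =>
    ((Pi.mulSingle i ζ * Pi.mulSingle j ζ⁻¹ : Fin n → Kˣ) k : K), ?_⟩, rfl⟩
  rw [Matrix.det_diagonal, ← Units.coe_prod]
  simp [Finset.prod_mul_distrib]

/-- The unit group is cyclic of order `(q - 1) * (q + 1)`; take the `(q - 1)`-th power of a
generator. -/
theorem exists_unit_pow_eq_one_ne_one {K : Type*} [Field K] {q : ℕ} (hq : 1 < q)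
    (hK : Nat.card K = q ^ 2) : ∃ t : Kˣ, t ^ (q + 1) = 1 ∧ t ≠ 1 := by
  have : Finite K := Nat.finite_of_card_ne_zero (by rw [hK]; positivity)
  obtain ⟨g, hg⟩ := IsCyclic.exists_ofOrder_eq_natCard (α := Kˣ)
  have h1 : orderOf g = (q - 1) * (q + 1) := by
    rw [hg, Nat.card_units, hK, mul_comm, ← Nat.sq_sub_sq, one_pow]
  refine ⟨g ^ (q - 1), ?_, fun h => ?_⟩
  · rw [← pow_mul, ← h1, pow_orderOf_eq_one]
  · have h2 := Nat.le_of_dvd (by lia) (orderOf_dvd_of_pow_eq_one h)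
    rw [h1] at h2
    have h3 := Nat.mul_le_mul_left (q - 1) (show 3 ≤ q + 1 by lia)
    lia

/-- The centre of `SU(n, q)` consists of scalar matrices when `3 ≤ n`. -/
theorem exists_eq_scalar_of_mem_center_finiteSU {n : ℕ} (hn : 3 ≤ n) {F K : Type*} [Field F]
    [Fintype F] [Field K] [Algebra F K] (hK : Nat.card K = Fintype.card F ^ 2)
    {z : finiteSU n F K} (hz : z ∈ Subgroup.center (finiteSU n F K)) :
    ∃ r : K, Matrix.scalar (Fin n) r = ((z : SL(n, K)) : Matrix (Fin n) (Fin n) K) := by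
  set A : Matrix (Fin n) (Fin n) K := ((z : SL(n, K)) : Matrix (Fin n) (Fin n) K)
  have hcomm : ∀ B : SL(n, K), B ∈ finiteSU n F K →
      (B : Matrix (Fin n) (Fin n) K) * A = A * (B : Matrix (Fin n) (Fin n) K) := by
    intro B hB
    have h1 := congrArg Subtype.val (Subgroup.mem_center_iff.mp hz ⟨B, hB⟩)
    simpa using congrArg Subtype.val h1
  have hne {i j : Fin n} (hij : i ≠ j) : ∃ k, k ≠ i ∧ k ≠ j := by
    obtain ⟨k, hk⟩ : ∃ k, k ∉ ({i, j} : Finset (Fin n)) := by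
      by_contra! h
      have := Finset.card_le_card (fun x _ => h x : Finset.univ ⊆ {i, j})
      have := Finset.card_le_two (a := i) (b := j)
      rw [Finset.card_univ, Fintype.card_fin] at *
      lia
    exact ⟨k, by simpa using hk⟩
  obtain ⟨t, ht, ht1⟩ := exists_unit_pow_eq_one_ne_one (Fintype.one_lt_card (α := F)) hK
  -- Commuting with the unitary matrix having `t` at `i` and `t⁻¹` at a third index `k` gives `t * A
  -- i j = A i j`.
  have hoff {i j : Fin n} (hij : i ≠ j) : A i j = 0 := by
    obtain ⟨k, hki, hkj⟩ := hne hij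
    obtain ⟨B, hB⟩ := exists_specialLinearGroup_eq_diagonal i k t
    have h1 := hcomm B (diagonal_mem_finiteSU B hB (by
      rw [mul_pow, ← Pi.mulSingle_pow, ← Pi.mulSingle_pow, inv_pow, ht]
      simp))
    rw [hB] at h1
    have h2 := congrFun (congrFun h1 i) j
    rw [Matrix.diagonal_mul, Matrix.mul_diagonal] at h2
    simp only [Pi.mul_apply, Pi.mulSingle_eq_same, Pi.mulSingle_eq_of_ne hki.symm,
      Pi.mulSingle_eq_of_ne hij.symm, Pi.mulSingle_eq_of_ne hkj.symm, mul_one, Units.val_one] at h2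
    by_contra h3
    exact ht1 (Units.ext (mul_right_cancel₀ h3 (by simpa using h2)))
  -- Even permutation matrices are unitary and carry any diagonal position to any other.
  have hdiag (i j : Fin n) : A i i = A j j := by
    rcases eq_or_ne i j with rfl | hij
    · rfl
    obtain ⟨σ, hσ, hσi⟩ := exists_perm_sign_eq_one (by simpa using hn) hij
    obtain ⟨B, hB⟩ := exists_specialLinearGroup_eq_permMatrixHom K hσ
    have h1 := hcomm B (permMatrixHom_mem_finiteSU B hB)
    have h2 : A = Matrix.diagonal fun k => A k k := by
      ext k l
      rcases eq_or_ne k l with rfl | hkl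
      · simp
      · rw [Matrix.diagonal_apply_ne _ hkl, hoff hkl]
    rw [hB, h2, permMatrixHom_mul_diagonal] at h1
    have h3 := congrFun (congrFun h1 j) i
    rw [Matrix.diagonal_mul, Matrix.diagonal_mul, Matrix.permMatrixHom_apply] at h3
    simpa [PEquiv.toMatrix_apply, ← hσi] using h3
  refine ⟨A ⟨0, by lia⟩ ⟨0, by lia⟩, ?_⟩
  ext i j
  rw [Matrix.scalar_apply]
  rcases eq_or_ne i j with rfl | hij
  · rw [Matrix.diagonal_apply_eq]
    exact hdiag _ _
  · rw [Matrix.diagonal_apply_ne _ hij, hoff hij]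

/-- A scalar matrix of determinant one and prime order `p` is given by a primitive `p`-th root of
unity, and `p` divides the degree. -/
theorem exists_unit_orderOf_eq_of_scalar {n p : ℕ} (hp : p.Prime) {K : Type*} [Field K]
    {z : SL(n, K)} (hz : orderOf z = p) {r : K}
    (hr : Matrix.scalar (Fin n) r = (z : Matrix (Fin n) (Fin n) K)) :
    ∃ ζ : Kˣ, (ζ : K) = r ∧ orderOf ζ = p ∧ p ∣ n := by
  have hn : r ^ n = 1 := by
    have h1 := congrArg Matrix.det hr
    simpa using h1
  have hz1 : z ≠ 1 := fun h => hp.ne_one (by rw [← hz, h, orderOf_one])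
  have : Nonempty (Fin n) := by
    by_contra h
    rw [not_nonempty_iff] at h
    exact hz1 (Subsingleton.elim _ _)
  have hn0 : n ≠ 0 := by
    rintro rfl
    exact (‹Nonempty (Fin 0)›).elim Fin.elim0
  have hrp : r ^ p = 1 := by
    have h1 : Matrix.scalar (Fin n) (r ^ p) = Matrix.scalar (Fin n) 1 := by
      rw [map_pow, hr, map_one, ← Matrix.SpecialLinearGroup.coe_pow, ← hz, pow_orderOf_eq_one,
        Matrix.SpecialLinearGroup.coe_one]
    exact Matrix.scalar_inj.mp h1
  have hr1 : r ≠ 1 := by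
    rintro rfl
    refine hz1 (Subtype.ext ?_)
    rw [← hr, map_one, Matrix.SpecialLinearGroup.coe_one]
  have hζp : (Units.ofPowEqOne r n hn hn0) ^ p = 1 := Units.ext (by simpa using hrp)
  have hζ1 : Units.ofPowEqOne r n hn hn0 ≠ 1 := fun h => hr1 (by simpa using congrArg Units.val h)
  have : Fact p.Prime := ⟨hp⟩
  have ho := orderOf_eq_prime hζp hζ1
  refine ⟨_, rfl, ho, ?_⟩
  rw [← ho, orderOf_dvd_iff_pow_eq_one]
  exact Units.ext (by simp)

/-! ### Conclusion for SL and SU -/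

theorem exists_mem_center_orderOf_eq {G : Type*} [Group G] [Finite G] {p : ℕ} (hp : p.Prime)
    (h : p ∣ Nat.card (Subgroup.center G)) : ∃ z ∈ Subgroup.center G, orderOf z = p := by
  have : Fact p.Prime := ⟨hp⟩
  obtain ⟨z, hz⟩ := exists_prime_orderOf_dvd_card' p h
  exact ⟨z, z.2, by rw [Subgroup.orderOf_coe, hz]⟩

theorem not_dvd_card_center_specialLinearGroup {n p : ℕ} (hp : p.Prime) (hp2 : p ≠ 2)
    (hn : 4 ≤ n) {F : Type*} [Field F] [Finite F] (P : Sylow p PSL(n, F))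
    (hP : ∀ a b : P ⧸ Subgroup.center P, a * b = b * a) :
    ¬ p ∣ Nat.card (Subgroup.center SL(n, F)) := by
  intro hdvd
  obtain ⟨z, hz, hzp⟩ := exists_mem_center_orderOf_eq hp hdvd
  obtain ⟨r, -, hr⟩ := Matrix.SpecialLinearGroup.mem_center_iff.mp hz
  obtain ⟨ζ, -, hζ, hpn⟩ := exists_unit_orderOf_eq_of_scalar hp hzp hr
  obtain ⟨y, hy⟩ := exists_specialLinearGroup_eq_diagonal (⟨0, by lia⟩ : Fin n) ⟨n - 1, by lia⟩ ζ
  exact false_of_sylow_quotient_comm hp hp2 hn (Nat.le_of_dvd (by lia) hpn)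
    (G := SL(n, F)) Matrix.SpecialLinearGroup.coeMonoidHom Subtype.val_injective
    (fun σ hσ => exists_specialLinearGroup_eq_permMatrixHom F hσ) hζ hy P hP

theorem not_dvd_card_center_finiteSU {n p : ℕ} (hp : p.Prime) (hp2 : p ≠ 2)
    (hn : 4 ≤ n) {F K : Type*} [Field F] [Fintype F] [Field K] [Algebra F K]
    (hK : Nat.card K = Fintype.card F ^ 2) (P : Sylow p (FinitePSU n F K))
    (hP : ∀ a b : P ⧸ Subgroup.center P, a * b = b * a) :
    ¬ p ∣ Nat.card (Subgroup.center (finiteSU n F K)) := by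
  intro hdvd
  have : Finite K := Nat.finite_of_card_ne_zero (by rw [hK]; positivity)
  obtain ⟨z, hz, hzp⟩ := exists_mem_center_orderOf_eq hp hdvd
  obtain ⟨r, hr⟩ := exists_eq_scalar_of_mem_center_finiteSU (by lia) hK hz
  obtain ⟨ζ, rfl, hζ, hpn⟩ :=
    exists_unit_orderOf_eq_of_scalar hp ((Subgroup.orderOf_coe z).trans hzp) hr
  -- The scalar `ζ` is itself unitary, so `ζ * ζ ^ q = 1`; this is what makes `y` unitary.
  have hζq : ζ ^ (Fintype.card F + 1) = 1 := by
    have h1 : ((z : SL(n, K)) : Matrix (Fin n) (Fin n) K) *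
      (((z : SL(n, K)) : Matrix (Fin n) (Fin n) K).map (unitaryConj F K)).transpose = 1 := z.2
    rw [← hr, Matrix.scalar_apply, Matrix.diagonal_map (map_zero _), Matrix.diagonal_transpose,
      Matrix.diagonal_mul_diagonal, ← Matrix.diagonal_one] at h1
    have h2 := congrFun (Matrix.diagonal_injective h1) ⟨0, by lia⟩
    rw [unitaryConj_apply, ← pow_succ'] at h2
    exact Units.ext (by simpa using h2)
  obtain ⟨y, hy⟩ := exists_specialLinearGroup_eq_diagonal (⟨0, by lia⟩ : Fin n) ⟨n - 1, by lia⟩ ζ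
  have hyU := diagonal_mem_finiteSU (F := F) y hy (by
    rw [mul_pow, ← Pi.mulSingle_pow, ← Pi.mulSingle_pow, inv_pow, hζq]
    simp)
  refine false_of_sylow_quotient_comm hp hp2 hn (Nat.le_of_dvd (by lia) hpn)
    (G := finiteSU n F K)
    (Matrix.SpecialLinearGroup.coeMonoidHom.comp (finiteSU n F K).subtype)
    (Subtype.val_injective.comp Subtype.val_injective) (fun σ hσ => ?_) hζ (y := ⟨y, hyU⟩) hy P hP
  obtain ⟨B, hB⟩ := exists_specialLinearGroup_eq_permMatrixHom K hσ
  exact ⟨⟨B, permMatrixHom_mem_finiteSU B hB⟩, hB⟩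

theorem theorem5p10 (p n q : ℕ) (hp : p.Prime) (hp2 : p ≠ 2) (hn : 4 ≤ n)
    (hnp : (n, p) ≠ (6, 3))
    (F : Type*) [Field F] [Fintype F] (hq : Fintype.card F = q) (hF : ringChar F ≠ p) :
    (∀ P : Sylow p PSL(n, F),
      (∀ a b : P ⧸ Subgroup.center P, a * b = b * a) →
        ¬ p ∣ Nat.card (Subgroup.center SL(n, F))) ∧
    (∀ (K : Type*) [Field K] [Algebra F K], Nat.card K = q ^ 2 →
      ∀ P : Sylow p (FinitePSU n F K),
        (∀ a b : P ⧸ Subgroup.center P, a * b = b * a) →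
          ¬ p ∣ Nat.card (Subgroup.center (finiteSU n F K))) := by
  subst hq
  exact ⟨fun P hP => not_dvd_card_center_specialLinearGroup hp hp2 hn P hP,
    fun K _ _ hK P hP => not_dvd_card_center_finiteSU hp hp2 hn hK P hP⟩
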